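/- **Theorem 1.5.** Fix an integer $k\ge 3$. There is a function $\delta'=\delta'_k:(0,\infty)\to\mathbb{R}$, depending only on $k$, with $\delta'(\delta)\to 0$ as $\delta\to 0^+$, such that the following holds. Let $\delta>0$, let $G$ be a finite abelian group with $N$ elements, and let $A_1,\dots,A_k\subseteq G$ be such that there are at most $\delta N^{k-1}$ tuples $(a_1,\dots,a_k)\in A_1\times\dots\times A_k$ with $a_1+\dots+a_k=0$. Then there are subsets $A_i'\subseteq A_i$ with $|A_i\setminus A_i'|\le\delta'(\delta)N$ for each $i=1,\dots,k$, such that there are no tuples $(a_1',\dots,a_k')\in A_1'\times\dots\times A_k'$ with $a_1'+\dots+a_k'=0$. -/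

import Mathlib

open Filter Topology

/-- The zero-sum `k`-tuples of `A₁ × ⋯ × A_k`: the tuples `a` with `a i ∈ A i` for all `i` and
`∑ i, a i = 0`. -/
def zeroSumTuples {G : Type*} [AddCommGroup G] [DecidableEq G] {k : ℕ} (A : Fin k → Finset G) :
    Finset (Fin k → G) :=
  (Fintype.piFinset A).filter (fun a => ∑ i, a i = 0)

/-!
# The removal lemma for zero-sum tuples in finite abelian groups

Zero-sum tuples are cycles in a Cayley graph (the argument of Král', Serra and Vena). Place `k`
copies of `G` in cyclic order and join `(i, x)` to `(i + 1, x + a)` for `a ∈ A i`. Around a cycle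
visiting the copies in order the labels sum to zero, so each zero-sum tuple corresponds to exactly
`N` such cycles, one for each starting point, and these are edge-disjoint
(`card_cayleyCycles_le`). If few edges meet all these cycles, discard from `A i` the labels which
lose at least `N / k` of their `N` edges: only few labels are discarded, while a surviving zero-sum
tuple would lose fewer than `N` edges in total although its `N` disjoint cycles are all hit
(`exists_subsets_of_edges`).

It remains to see that few cycles can be met by few edges (`coloured_cycle_removal`). As usual, this
follows from Szemerédi's regularity lemma. The regularity partition need not refine the partition
of the vertices into colour classes; the edges removed are those inside parts, those between
non-uniform pairs of parts, and those between two cells (intersections of a part with a colour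
class) of consecutive colours that span few edges compared with the sizes of the full parts
(`card_sparseCellEdges_le`). The cells met by a surviving cycle are then large and inherit a
one-sided form of regularity (`SimpleGraph.IsUniform.lowerRegular`), and a greedy count gives many
cycles through them (`le_card_closedWalks`), too many for the hypothesis.

The dependence of the loss on `δ` is packaged by taking, for each `δ`, slightly more than the
infimum of all admissible losses.
-/

open Finset

/-! ### Counting closed walks through lower-regular pairs -/

section Counting

variable {α : Type*} (G : SimpleGraph α) [DecidableRel G.Adj]

/-- The pair `(S, T)` is lower `d`-regular in `G`: any two subsets containing at least a proportion
`d` of `S` and of `T` span edges with density at least `d`. A single parameter plays both roles. -/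
def SimpleGraph.LowerRegular (d : ℝ) (S T : Finset α) : Prop :=
  ∀ A ⊆ S, ∀ B ⊆ T, d * #S ≤ #A → d * #T ≤ #B → d * #A * #B ≤ #(G.interedges A B)

variable {G} {d : ℝ} {S T : Finset α}

lemma SimpleGraph.LowerRegular.symm (h : G.LowerRegular d S T) : G.LowerRegular d T S := by
  intro A hA B hB hcA hcB
  have := h B hB A hA hcB hcA
  have e : #(G.interedges A B) = #(G.interedges B A) :=
    have : Std.Symm G.Adj := ⟨fun _ _ h => h.symm⟩
    Rel.card_interedges_comm (r := G.Adj) A B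
  rw [e]
  linarith

lemma card_interedges_eq_sum (A B : Finset α) :
    #(G.interedges A B) = ∑ b ∈ B, #{a ∈ A | G.Adj a b} := by
  rw [SimpleGraph.interedges_def, card_filter, sum_product_right]
  refine sum_congr rfl fun b _ => ?_
  rw [card_filter]

/-- Fewer than `d * #T` vertices of `T` have fewer than `d * #A` neighbours in a large subset `A`
of `S`. -/
lemma SimpleGraph.LowerRegular.card_lt (h : G.LowerRegular d S T) (hd : 0 < d)
    (hT : T.Nonempty) {A : Finset α} (hAS : A ⊆ S) (hA : d * #S ≤ #A) :
    (#{b ∈ T | (#{a ∈ A | G.Adj a b} : ℝ) < d * #A} : ℝ) < d * #T := by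
  by_contra! hB
  set B := {b ∈ T | (#{a ∈ A | G.Adj a b} : ℝ) < d * #A} with hBdef
  have hT' : (0 : ℝ) < #T := by exact_mod_cast hT.card_pos
  have hBne : B.Nonempty := by
    rw [← card_pos]
    have : (0 : ℝ) < #B := lt_of_lt_of_le (by positivity) hB
    exact_mod_cast this
  have h1 := h A hAS B (filter_subset _ _) hA hB
  have h2 : (#(G.interedges A B) : ℝ) < ∑ b ∈ B, d * #A := by
    rw [card_interedges_eq_sum]
    push_cast
    exact sum_lt_sum_of_nonempty hBne fun b hb => (mem_filter.1 hb).2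
  rw [sum_const, nsmul_eq_mul] at h2
  linarith

lemma SimpleGraph.LowerRegular.le_card (h : G.LowerRegular d S T) (hd : 0 < d)
    (hT : T.Nonempty) {A : Finset α} (hAS : A ⊆ S) (hA : d * #S ≤ #A) :
    (1 - d) * #T ≤ (#{b ∈ T | d * #A ≤ (#{a ∈ A | G.Adj a b} : ℝ)} : ℝ) := by
  have h1 := h.card_lt hd hT hAS hA
  have h2 := card_filter_add_card_filter_not (s := T)
    (fun b => (#{a ∈ A | G.Adj a b} : ℝ) < d * #A)
  simp only [not_lt] at h2
  rw [← h2] at h1 ⊢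
  push_cast at h1 ⊢
  linarith

variable [Fintype α] [DecidableEq α]

/-- The walks `x 0, …, x (m + 1)` in `G` with `x i ∈ S i` for all `i`, starting in `A` and ending
in `B`. -/
def walksThrough (G : SimpleGraph α) [DecidableRel G.Adj] {m : ℕ} (S : Fin (m + 2) → Finset α)
    (A B : Finset α) : Finset (Fin (m + 2) → α) :=
  {x | x 0 ∈ A ∧ x (Fin.last _) ∈ B ∧ (∀ i, x i ∈ S i) ∧
    ∀ i : Fin (m + 1), G.Adj (x i.castSucc) (x i.succ)}

/-- Along a chain of lower-regular pairs, many walks lead from a large subset of the first set to a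
large subset of the last one. The induction peels off the first vertex: most vertices of the second
set have many neighbours in `A`, and they form the starting set of the shorter walks. -/
lemma le_card_walksThrough {M : ℝ} (hd : 0 < d) (hd2 : d ≤ 1 / 2) (hM : 0 < M) :
    ∀ {m : ℕ} (S : Fin (m + 2) → Finset α), (∀ i, M ≤ #(S i)) →
      (∀ i : Fin (m + 1), G.LowerRegular d (S i.castSucc) (S i.succ)) →
      ∀ A ⊆ S 0, ∀ B ⊆ S (Fin.last _), d * #(S 0) ≤ #A → d * #(S (Fin.last _)) ≤ #B →
        (d * d * M) ^ m * (d * #A * #B) ≤ #(walksThrough G S A B) := by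
  intro m
  induction m with
  | zero =>
    intro S hS hreg A hA B hB hcA hcB
    have h := hreg 0 A hA B hB hcA hcB
    rw [pow_zero, one_mul]
    refine h.trans ?_
    norm_cast
    refine card_le_card_of_injOn (fun p => ![p.1, p.2]) ?_ ?_
    · rintro ⟨a, b⟩ hab
      rw [mem_coe, SimpleGraph.mk_mem_interedges_iff] at hab
      obtain ⟨ha, hb, hab⟩ := hab
      simp only [walksThrough, coe_filter, mem_univ, true_and, Set.mem_ofPred_eq]
      refine ⟨ha, hb, ?_, ?_⟩
      · intro i
        fin_cases i
        · exact hA ha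
        · exact hB hb
      · intro i
        fin_cases i
        exact hab
    · rintro ⟨a, b⟩ _ ⟨a', b'⟩ _ h
      have h0 := congrFun h 0
      have h1 := congrFun h 1
      simp at h0 h1
      rw [h0, h1]
  | succ m ih =>
    intro S hS hreg A hA B hB hcA hcB
    have hne : (S 1).Nonempty := by
      rw [← card_pos]
      have := hM.trans_le (hS 1)
      exact_mod_cast this
    have hreg0 : G.LowerRegular d (S 0) (S 1) := hreg 0
    have hV := hreg0.le_card hd hne hA hcA
    set V := {b ∈ S 1 | d * #A ≤ (#{a ∈ A | G.Adj a b} : ℝ)} with hVdef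
    have hVd : d * #(S 1) ≤ #V := by
      refine le_trans ?_ hV
      gcongr
      linarith
    have key := ih (fun i => S i.succ) (fun i => hS _) (fun i => hreg i.succ) V
      (filter_subset _ _) B hB hVd hcB
    have hcount : d * #A * #(walksThrough G (fun i => S i.succ) V B) ≤
        (#(walksThrough G S A B) : ℝ) := by
      calc d * #A * #(walksThrough G (fun i => S i.succ) V B)
          = ∑ y ∈ walksThrough G (fun i => S i.succ) V B, d * #A := by
            rw [sum_const, nsmul_eq_mul, mul_comm]
        _ ≤ ∑ y ∈ walksThrough G (fun i => S i.succ) V B, (#{a ∈ A | G.Adj a (y 0)} : ℝ) := by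
            refine sum_le_sum fun y hy => ?_
            have : y 0 ∈ V := (mem_filter.1 hy).2.1
            exact (mem_filter.1 this).2
        _ = #((walksThrough G (fun i => S i.succ) V B).sigma
              fun y => {a ∈ A | G.Adj a (y 0)}) := by
            rw [card_sigma]; push_cast; rfl
        _ ≤ _ := by
            norm_cast
            refine card_le_card_of_injOn (fun p => Fin.cons p.2 p.1) ?_ ?_
            · rintro ⟨y, a⟩ hya
              simp only [walksThrough, coe_sigma, Set.mem_sigma_iff, coe_filter, mem_univ,
                true_and, Set.mem_ofPred_eq] at hya ⊢
              obtain ⟨⟨-, h1, h2, h3⟩, h4, h5⟩ := hya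
              refine ⟨h4, ?_, ?_, ?_⟩
              · rw [← Fin.succ_last, Fin.cons_succ]; exact h1
              · intro i
                refine Fin.cases ?_ (fun j => ?_) i
                · exact hA h4
                · rw [Fin.cons_succ]; exact h2 j
              · intro i
                refine Fin.cases ?_ (fun j => ?_) i
                · exact h5
                · rw [← Fin.succ_castSucc, Fin.cons_succ, Fin.cons_succ]; exact h3 j
            · rintro ⟨y, a⟩ _ ⟨y', a'⟩ _ h
              obtain ⟨rfl, rfl⟩ := Fin.cons_inj.1 h
              rfl
    refine le_trans ?_ hcount
    have hVM : d * M ≤ #V := by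
      refine le_trans ?_ hVd
      have := hS 1
      gcongr
    calc (d * d * M) ^ (m + 1) * (d * #A * #B)
        = d * #A * ((d * d * M) ^ m * (d * (d * M) * #B)) := by ring
      _ ≤ d * #A * ((d * d * M) ^ m * (d * #V * #B)) := by gcongr
      _ ≤ _ := by gcongr

/-- Cyclically arranged lower-regular pairs carry a positive proportion of all conceivable closed
walks. -/
lemma le_card_closedWalks {M : ℝ} (hd : 0 < d) (hd3 : d ≤ 1 / 3) (hM : 0 < M) {m : ℕ}
    (S : Fin (m + 3) → Finset α) (hS : ∀ i, M ≤ #(S i))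
    (hreg : ∀ i, G.LowerRegular d (S i) (S (i + 1))) :
    M / 3 * ((d * d * M) ^ m * (d * (d * M) * (d * M))) ≤
      #{x : Fin (m + 3) → α | (∀ i, x i ∈ S i) ∧ ∀ i, G.Adj (x i) (x (i + 1))} := by
  have hpos : ∀ i, (0 : ℝ) < #(S i) := fun i => hM.trans_le (hS i)
  have hne : ∀ i, (S i).Nonempty := fun i => by
    rw [← card_pos]; exact_mod_cast hpos i
  have hfull : ∀ i, d * #(S i) ≤ #(S i) := fun i =>
    mul_le_of_le_one_left (hpos i).le (by linarith)
  have hr1 : G.LowerRegular d (S 1) (S 0) := by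
    have := hreg 0
    rw [zero_add] at this
    exact this.symm
  have hr2 : G.LowerRegular d (S (Fin.last _)) (S 0) := by
    have := hreg (Fin.last _)
    rwa [Fin.last_add_one] at this
  have b1 := hr1.card_lt hd (hne 0) subset_rfl (hfull _)
  have b2 := hr2.card_lt hd (hne 0) subset_rfl (hfull _)
  set B1 := {b ∈ S 0 | (#{a ∈ S 1 | G.Adj a b} : ℝ) < d * #(S 1)}
  set B2 := {b ∈ S 0 | (#{a ∈ S (Fin.last _) | G.Adj a b} : ℝ) < d * #(S (Fin.last _))}
  set V := S 0 \ (B1 ∪ B2) with hV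
  have hVM : M / 3 ≤ #V := by
    have h1 : (#(S 0) : ℝ) ≤ #V + (#B1 + #B2) := by
      have h2 : #(S 0) ≤ #V + #(B1 ∪ B2) := by
        have := le_card_sdiff (B1 ∪ B2) (S 0)
        rw [← hV] at this
        omega
      have h3 := card_union_le B1 B2
      exact_mod_cast h2.trans (by omega)
    have h4 : d * #(S 0) ≤ 1 / 3 * #(S 0) := by gcongr
    linarith [hS 0]
  -- `W v` consists of the closed walks based at the typical vertex `v`, with `v` removed.
  let W : α → Finset (Fin (m + 2) → α) := fun v =>
    walksThrough G (fun i => S i.succ) {a ∈ S 1 | G.Adj a v} {a ∈ S (Fin.last _) | G.Adj a v}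
  have hW : ∀ v ∈ V, (d * d * M) ^ m * (d * (d * M) * (d * M)) ≤ (#(W v) : ℝ) := by
    intro v hv
    simp only [hV, B1, B2, Finset.mem_sdiff, mem_union, mem_filter, not_or, not_and, not_lt] at hv
    obtain ⟨hv0, hv1, hv2⟩ := hv
    have h1 := hv1 hv0
    have h2 := hv2 hv0
    have := le_card_walksThrough (G := G) hd (by linarith) hM (fun i => S i.succ) (fun i => hS _)
      (fun i => by
        have := hreg i.succ.castSucc
        rwa [Fin.coeSucc_eq_succ, ← Fin.succ_castSucc] at this)
      {a ∈ S 1 | G.Adj a v} (filter_subset _ _) {a ∈ S (Fin.last _) | G.Adj a v}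
      (filter_subset _ _) h1 h2
    refine le_trans ?_ this
    have h1' : d * M ≤ (#{a ∈ S 1 | G.Adj a v} : ℝ) := le_trans (by gcongr; exact hS _) h1
    have h2' : d * M ≤ (#{a ∈ S (Fin.last _) | G.Adj a v} : ℝ) :=
      le_trans (by gcongr; exact hS _) h2
    gcongr
  calc M / 3 * ((d * d * M) ^ m * (d * (d * M) * (d * M)))
      ≤ #V * ((d * d * M) ^ m * (d * (d * M) * (d * M))) := by gcongr
    _ = ∑ v ∈ V, (d * d * M) ^ m * (d * (d * M) * (d * M)) := by
        rw [sum_const, nsmul_eq_mul]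
    _ ≤ ∑ v ∈ V, (#(W v) : ℝ) := sum_le_sum hW
    _ = #(V.sigma W) := by rw [card_sigma]; push_cast; rfl
    _ ≤ _ := by
        norm_cast
        refine card_le_card_of_injOn (fun p => Fin.cons p.1 p.2) ?_ ?_
        · rintro ⟨v, y⟩ hvy
          simp only [W, walksThrough, coe_sigma, Set.mem_sigma_iff, coe_filter, mem_filter,
            mem_univ, true_and, Set.mem_ofPred_eq] at hvy ⊢
          obtain ⟨hv, ⟨-, h1⟩, ⟨-, h2⟩, h3, h4⟩ := hvy
          refine ⟨?_, ?_⟩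
          · intro i
            refine Fin.cases ?_ (fun j => ?_) i
            · exact (Finset.mem_sdiff.1 hv).1
            · rw [Fin.cons_succ]; exact h3 j
          · intro i
            refine Fin.lastCases ?_ (fun j => ?_) i
            · rw [Fin.last_add_one, ← Fin.succ_last, Fin.cons_succ]; exact h2
            · rw [Fin.coeSucc_eq_succ, Fin.cons_succ]
              refine Fin.cases ?_ (fun j => ?_) j
              · exact h1.symm
              · rw [← Fin.succ_castSucc, Fin.cons_succ]; exact h4 j
        · rintro ⟨v, y⟩ _ ⟨v', y'⟩ _ h
          obtain ⟨rfl, rfl⟩ := Fin.cons_inj.1 h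
          rfl

end Counting

/-! ### Removal of coloured cycles -/

section Removal

lemma lt_two_mul_mul_div {n k : ℕ} (hk : 0 < k) (hn : k ≤ n) : n < 2 * k * (n / k) := by
  have h1 := Nat.mod_add_div n k
  have h2 := Nat.mod_lt n hk
  have h3 : k * 1 ≤ k * (n / k) := Nat.mul_le_mul_left k ((Nat.one_le_div_iff hk).2 hn)
  rw [mul_assoc]
  omega

variable {α : Type*} {G : SimpleGraph α} [DecidableRel G.Adj]

/-- A uniform pair induces a lower-regular pair on any two subsets spanning many edges. -/
lemma SimpleGraph.IsUniform.lowerRegular {d ε : ℝ} {U W S T : Finset α} (h : G.IsUniform ε U W)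
    (hd : 0 < d) (hε1 : ε ≤ d / 4) (hε2 : ε ≤ d * d / 2) (hS : S ⊆ U) (hT : T ⊆ W)
    (hU : U.Nonempty) (hW : W.Nonempty) (he : d * #U * #W ≤ #(G.interedges S T)) :
    d * #U ≤ #S ∧ d * #W ≤ #T ∧ G.LowerRegular (d / 2) S T := by
  have hU' : (0 : ℝ) < #U := by exact_mod_cast hU.card_pos
  have hW' : (0 : ℝ) < #W := by exact_mod_cast hW.card_pos
  have hSU : (#S : ℝ) ≤ #U := by exact_mod_cast card_le_card hS
  have hTW : (#T : ℝ) ≤ #W := by exact_mod_cast card_le_card hT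
  have hST : (#(G.interedges S T) : ℝ) ≤ #S * #T := by
    exact_mod_cast G.card_interedges_le_mul S T
  have h1 : d * #U ≤ #S := by
    have : d * #U * #W ≤ #S * #W := he.trans (hST.trans (by gcongr))
    exact le_of_mul_le_mul_right this hW'
  have h2 : d * #W ≤ #T := by
    have : #U * (d * #W) ≤ #U * (#T : ℝ) := by
      calc _ = d * #U * #W := by ring
        _ ≤ #S * #T := he.trans hST
        _ ≤ _ := by gcongr
    exact le_of_mul_le_mul_left this hU'
  have hS' : (0 : ℝ) < #S := lt_of_lt_of_le (by positivity) h1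
  have hT' : (0 : ℝ) < #T := lt_of_lt_of_le (by positivity) h2
  have dens : ∀ A B : Finset α, (G.edgeDensity A B : ℝ) = #(G.interedges A B) / (#A * #B) := by
    intro A B
    rw [SimpleGraph.edgeDensity_def]
    push_cast
    rfl
  have h3 : d ≤ G.edgeDensity S T := by
    rw [dens, le_div_iff₀ (by positivity)]
    refine le_trans ?_ he
    rw [mul_assoc]
    gcongr
  have h4 := abs_lt.1 (h hS hT (by nlinarith) (by nlinarith))
  refine ⟨h1, h2, fun A hA B hB hcA hcB => ?_⟩
  have hA' : #U * ε ≤ (#A : ℝ) := by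
    calc #U * ε ≤ #U * (d * d / 2) := by gcongr
      _ = d / 2 * (d * #U) := by ring
      _ ≤ d / 2 * #S := by gcongr
      _ ≤ _ := hcA
  have hB' : #W * ε ≤ (#B : ℝ) := by
    calc #W * ε ≤ #W * (d * d / 2) := by gcongr
      _ = d / 2 * (d * #W) := by ring
      _ ≤ d / 2 * #T := by gcongr
      _ ≤ _ := hcB
  have h5 := abs_lt.1 (h (hA.trans hS) (hB.trans hT) hA' hB')
  have h6 : d / 2 ≤ G.edgeDensity A B := by linarith [h4.2, h5.1]
  have hApos : (0 : ℝ) < #A := lt_of_lt_of_le (by positivity) hcA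
  have hBpos : (0 : ℝ) < #B := lt_of_lt_of_le (by positivity) hcB
  rwa [dens, le_div_iff₀ (by positivity), ← mul_assoc] at h6

variable [DecidableEq α] [Fintype α]

lemma Finpartition.IsEquipartition.div_le_card {P : Finpartition (univ : Finset α)}
    (hP : P.IsEquipartition) {b : ℕ} (hb : #P.parts ≤ b) {s : Finset α} (hs : s ∈ P.parts) :
    (Fintype.card α : ℝ) / (2 * b) ≤ #s := by
  have h0 : 0 < #P.parts := card_pos.2 ⟨s, hs⟩
  have h0' : (0 : ℝ) < #P.parts := by exact_mod_cast h0
  have hcard : #P.parts ≤ Fintype.card α := by simpa using P.card_parts_le_card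
  have h1 := lt_two_mul_mul_div h0 hcard
  have h2 : Fintype.card α / #P.parts ≤ #s := by
    simpa using hP.average_le_card_part hs
  calc (Fintype.card α : ℝ) / (2 * b) ≤ Fintype.card α / (2 * #P.parts) := by gcongr
    _ ≤ ((Fintype.card α / #P.parts : ℕ) : ℝ) := by
        rw [div_le_iff₀' (by positivity)]
        exact_mod_cast h1.le
    _ ≤ #s := by exact_mod_cast h2

/-- The edges `(a, b)` of `G` with `c b = c a + 1` for which the colour classes of `a` and `b` are
sparse to each other inside the parts of `P` containing `a` and `b`. Sparsity is measured relative to the full parts, so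
that a non-sparse pair of cells automatically occupies a positive proportion of both parts. -/
noncomputable def sparseCellEdges (G : SimpleGraph α) [DecidableRel G.Adj] {k : ℕ} [NeZero k]
    (c : α → Fin k) (P : Finpartition (univ : Finset α)) (d : ℝ) : Finset (α × α) :=
  ((P.parts ×ˢ P.parts) ×ˢ univ).biUnion fun q =>
    if (#(G.interedges {a ∈ q.1.1 | c a = q.2} {b ∈ q.1.2 | c b = q.2 + 1}) : ℝ)
        < d * #q.1.1 * #q.1.2
    then G.interedges {a ∈ q.1.1 | c a = q.2} {b ∈ q.1.2 | c b = q.2 + 1} else ∅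

lemma card_sparseCellEdges_le {k : ℕ} [NeZero k] (c : α → Fin k)
    (P : Finpartition (univ : Finset α)) {d : ℝ} (hd : 0 < d) :
    (#(sparseCellEdges G c P d) : ℝ) ≤ k * d * (Fintype.card α : ℝ) ^ 2 := by
  have hP : ∑ U ∈ P.parts, (#U : ℝ) = Fintype.card α := by
    exact_mod_cast P.sum_card_parts
  calc (#(sparseCellEdges G c P d) : ℝ)
      ≤ ∑ q ∈ (P.parts ×ˢ P.parts) ×ˢ (univ : Finset (Fin k)),
          (#(if (#(G.interedges {a ∈ q.1.1 | c a = q.2} {b ∈ q.1.2 | c b = q.2 + 1}) : ℝ)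
              < d * #q.1.1 * #q.1.2
            then G.interedges {a ∈ q.1.1 | c a = q.2} {b ∈ q.1.2 | c b = q.2 + 1}
            else ∅) : ℝ) := by
        exact_mod_cast card_biUnion_le
    _ ≤ ∑ q ∈ (P.parts ×ˢ P.parts) ×ˢ (univ : Finset (Fin k)), d * #q.1.1 * #q.1.2 := by
        refine sum_le_sum fun q _ => ?_
        split_ifs with h
        · exact h.le
        · rw [card_empty, Nat.cast_zero]; positivity
    _ = k * d * (Fintype.card α : ℝ) ^ 2 := by
        rw [sum_product]
        simp only [sum_const, card_univ, Fintype.card_fin, nsmul_eq_mul]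
        rw [← mul_sum, sum_product]
        simp only [mul_assoc]
        simp only [← mul_sum, ← sum_mul]
        rw [hP]
        ring

/-- **Cycle removal lemma**, for cycles visiting `k ≥ 3` colour classes in cyclic order: if there
are few of them, then some small set `D` of edges meets them all. -/
lemma coloured_cycle_removal (m : ℕ) {ε : ℝ} (hε : 0 < ε) :
    ∃ δ : ℝ, 0 < δ ∧ ∀ (α : Type*) [Fintype α] (G : SimpleGraph α) (c : α → Fin (m + 3)),
      (Nat.card {x : Fin (m + 3) → α // (∀ i, c (x i) = i) ∧ ∀ i, G.Adj (x i) (x (i + 1))} : ℝ)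
        ≤ δ * (Fintype.card α : ℝ) ^ (m + 3) →
      ∃ D : Finset (α × α), (#D : ℝ) ≤ ε * (Fintype.card α : ℝ) ^ 2 ∧
        ∀ x : Fin (m + 3) → α, (∀ i, c (x i) = i) → (∀ i, G.Adj (x i) (x (i + 1))) →
          ∃ i, (x i, x (i + 1)) ∈ D := by
  classical
  set d : ℝ := min (1 / 4) (ε / (4 * (m + 3))) with hd_def
  have hd : 0 < d := by positivity
  have hd4 : d ≤ 1 / 4 := min_le_left _ _
  have hdε : (m + 3) * d ≤ ε / 4 := by
    have : d ≤ ε / (4 * (m + 3)) := min_le_right _ _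
    rw [le_div_iff₀ (by positivity)] at this
    linarith
  have hdε' : d ≤ ε / 4 := by nlinarith [(Nat.cast_nonneg m : (0 : ℝ) ≤ m)]
  set η : ℝ := d * d / 4 with hη_def
  have hη : 0 < η := by positivity
  set l : ℕ := ⌈4 / (ε / 2)⌉₊ with hl_def
  have hl : 4 / (ε / 2) ≤ l := Nat.le_ceil _
  have hl0 : 0 < l := Nat.ceil_pos.2 (by positivity)
  set b : ℕ := SzemerediRegularity.bound η l with hb_def
  have hb : 0 < b := SzemerediRegularity.bound_pos _ _
  have hb' : (0 : ℝ) < b := by exact_mod_cast hb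
  -- `q * n` bounds from below the size of the cells left by the cleaning of a graph of order `n`.
  set q : ℝ := d / (2 * b) with hq_def
  have hq : 0 < q := by positivity
  set e : ℝ := d / 2 with he_def
  have he : 0 < e := by positivity
  set κ : ℝ := q / 3 * ((e * e * q) ^ m * (e * (e * q) * (e * q))) with hκ_def
  have hκ : 0 < κ := by positivity
  have hl0' : (0 : ℝ) < l := by exact_mod_cast hl0
  refine ⟨min (1 / (2 * (l : ℝ) ^ (m + 3))) (κ / 2), by positivity, ?_⟩
  intro α _ G c hcount
  set n := Fintype.card α with hn_def
  set X : Finset (Fin (m + 3) → α) :=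
    {x | (∀ i, c (x i) = i) ∧ ∀ i, G.Adj (x i) (x (i + 1))} with hX
  have hcard : Nat.card {x : Fin (m + 3) → α // (∀ i, c (x i) = i) ∧
      ∀ i, G.Adj (x i) (x (i + 1))} = #X := by
    rw [Nat.card_eq_fintype_card, Fintype.card_subtype]
  rw [hcard] at hcount
  -- In a small graph the hypothesis excludes coloured cycles altogether.
  rcases lt_or_ge n l with hnl | hnl
  · refine ⟨∅, by rw [card_empty, Nat.cast_zero]; positivity, fun x hx1 hx2 => ?_⟩
    exfalso
    have hx : x ∈ X := mem_filter.2 ⟨mem_univ _, hx1, hx2⟩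
    have h1 : (1 : ℝ) ≤ #X := by exact_mod_cast card_pos.2 ⟨x, hx⟩
    have h2 : min (1 / (2 * (l : ℝ) ^ (m + 3))) (κ / 2) * (n : ℝ) ^ (m + 3) ≤ 1 / 2 := by
      calc _ ≤ 1 / (2 * (l : ℝ) ^ (m + 3)) * (l : ℝ) ^ (m + 3) := by
            gcongr
            exact min_le_left _ _
        _ = 1 / 2 := by field_simp
    linarith
  have hn : (0 : ℝ) < n := by exact_mod_cast hl0.trans_le hnl
  have : Nonempty α := Fintype.card_pos_iff.1 (hl0.trans_le hnl)
  obtain ⟨P, hP1, hP2, hP3, hP4⟩ := szemeredi_regularity G hη hnl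
  refine ⟨(P.nonUniforms G η).biUnion (fun UW => UW.1 ×ˢ UW.2) ∪ P.parts.biUnion offDiag ∪
    sparseCellEdges G c P d, ?_, ?_⟩
  · have h1 := hP1.sum_nonUniforms_lt univ_nonempty hη hP4
    have h2 := hP1.card_biUnion_offDiag_le (half_pos hε) (hl.trans (by exact_mod_cast hP2))
    have h3 := card_sparseCellEdges_le (G := G) c P hd
    rw [card_univ, ← hn_def] at h1 h2
    rw [← hn_def] at h3
    push_cast at h3
    have hn2 : (0 : ℝ) < (n : ℝ) ^ 2 := by positivity
    have h4 : 4 * η * (n : ℝ) ^ 2 ≤ ε / 4 * (n : ℝ) ^ 2 := by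
      gcongr
      nlinarith
    have h5 : (m + 3) * d * (n : ℝ) ^ 2 ≤ ε / 4 * (n : ℝ) ^ 2 := by gcongr
    calc _ ≤ (#((P.nonUniforms G η).biUnion fun UW => UW.1 ×ˢ UW.2) : ℝ) +
          #(P.parts.biUnion offDiag) + #(sparseCellEdges G c P d) := by
          exact_mod_cast (card_union_le _ _).trans (Nat.add_le_add_right (card_union_le _ _) _)
      _ ≤ _ := by nlinarith
  · intro x hx1 hx2
    by_contra! hxD
    choose U hUP hxU using fun i => P.exists_mem (mem_univ (x i))
    -- The cells containing the vertices of a surviving cycle are large and lower-regular.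
    have key : ∀ i, d * #(U i) ≤ #{a ∈ U i | c a = i} ∧
        G.LowerRegular e {a ∈ U i | c a = i} {a ∈ U (i + 1) | c a = i + 1} := by
      intro i
      have hi := hxD i
      simp only [mem_union, not_or] at hi
      obtain ⟨⟨hi1, hi2⟩, hi3⟩ := hi
      have hne : U i ≠ U (i + 1) := by
        intro hU
        refine hi2 (mem_biUnion.2 ⟨U i, hUP i, mem_offDiag.2 ⟨hxU i, ?_, (hx2 i).ne⟩⟩)
        rw [hU]
        exact hxU _
      have hunif : G.IsUniform η (U i) (U (i + 1)) := by
        by_contra hnon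
        exact hi1 (mem_biUnion.2 ⟨(U i, U (i + 1)),
          (P.mk_mem_nonUniforms G).2 ⟨hUP i, hUP _, hne, hnon⟩,
          mem_product.2 ⟨hxU i, hxU _⟩⟩)
      have hdense : d * #(U i) * #(U (i + 1)) ≤
          (#(G.interedges {a ∈ U i | c a = i} {a ∈ U (i + 1) | c a = i + 1}) : ℝ) := by
        by_contra! hlt
        refine hi3 (mem_biUnion.2 ⟨((U i, U (i + 1)), i), ?_, ?_⟩)
        · exact mem_product.2 ⟨mem_product.2 ⟨hUP i, hUP _⟩, mem_univ _⟩
        · rw [if_pos hlt, SimpleGraph.mk_mem_interedges_iff]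
          exact ⟨mem_filter.2 ⟨hxU i, hx1 i⟩, mem_filter.2 ⟨hxU _, hx1 _⟩, hx2 i⟩
      have := hunif.lowerRegular hd (by nlinarith) (by nlinarith) (filter_subset _ _)
        (filter_subset _ _) ⟨_, hxU i⟩ ⟨_, hxU (i + 1)⟩ hdense
      exact ⟨this.1, this.2.2⟩
    have hM : ∀ i, q * n ≤ (#{a ∈ U i | c a = i} : ℝ) := by
      intro i
      refine le_trans ?_ (key i).1
      have := hP1.div_le_card hP3 (hUP i)
      calc q * n = d * (n / (2 * b)) := by rw [hq_def]; ring
        _ ≤ _ := by gcongr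
    have hmany := le_card_closedWalks (G := G) he (by linarith) (mul_pos hq hn)
      (fun i => {a ∈ U i | c a = i}) hM (fun i => (key i).2)
    have hsub : #{y : Fin (m + 3) → α | (∀ i, y i ∈ ({a ∈ U i | c a = i} : Finset α)) ∧
        ∀ i, G.Adj (y i) (y (i + 1))} ≤ #X := by
      refine card_le_card fun y hy => ?_
      obtain ⟨-, hy1, hy2⟩ := mem_filter.1 hy
      exact mem_filter.2 ⟨mem_univ _, fun i => (mem_filter.1 (hy1 i)).2, hy2⟩
    have hsub' : κ * (n : ℝ) ^ (m + 3) ≤ #X := by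
      refine le_trans (le_of_eq ?_) (hmany.trans (by exact_mod_cast hsub))
      rw [hκ_def]
      ring
    have hlt : min (1 / (2 * (l : ℝ) ^ (m + 3))) (κ / 2) * (n : ℝ) ^ (m + 3)
        ≤ κ / 2 * (n : ℝ) ^ (m + 3) := by
      gcongr
      exact min_le_right _ _
    have : 0 < κ * (n : ℝ) ^ (m + 3) := by positivity
    linarith

end Removal

/-! ### Zero-sum tuples as cycles of a Cayley graph -/

section Arithmetic

variable {G : Type*} [AddCommGroup G]

lemma exists_cyclic_antidifference {n : ℕ} (a : Fin (n + 1) → G) (ha : ∑ i, a i = 0) :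
    ∃ s : Fin (n + 1) → G, ∀ i, s (i + 1) = s i + a i := by
  refine ⟨fun i => Fin.partialSum a i.castSucc, fun i => ?_⟩
  rw [← Fin.partialSum_succ]
  refine Fin.lastCases ?_ (fun j => ?_) i
  · beta_reduce
    rw [Fin.last_add_one, Fin.castSucc_zero, Fin.partialSum_zero, ← ha, ← Fin.sum_ofFn]
    simp [Fin.partialSum, List.take_of_length_le]
  · rw [Fin.coeSucc_eq_succ, Fin.succ_castSucc]

/-- The `k`-partite Cayley graph of a family of subsets: `(i, x)` is joined to `(i + 1, x + a)` for
every `a ∈ A i`. -/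
def cayleyCycleGraph {k : ℕ} [NeZero k] (A : Fin k → Finset G) : SimpleGraph (Fin k × G) :=
  SimpleGraph.fromRel fun p q => q.1 = p.1 + 1 ∧ q.2 - p.2 ∈ A p.1

/-- With at least three layers the two orientations of an edge cannot be confused. -/
lemma cayleyCycleGraph_adj {m : ℕ} (A : Fin (m + 3) → Finset G) (i : Fin (m + 3)) (x y : G) :
    (cayleyCycleGraph A).Adj (i, x) (i + 1, y) ↔ y - x ∈ A i := by
  have h1 : i ≠ i + 1 := by simp
  have h2 : i ≠ i + 1 + 1 := by
    rw [add_assoc, ne_eq, left_eq_add, Fin.ext_iff, Fin.val_add]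
    simp [Nat.mod_eq_of_lt (show 2 < m + 3 by omega)]
  simp [cayleyCycleGraph, SimpleGraph.fromRel_adj, h1, h2]

variable [Fintype G] [DecidableEq G]

lemma card_cayleyCycles_le {m : ℕ} (A : Fin (m + 3) → Finset G) :
    Nat.card {x : Fin (m + 3) → Fin (m + 3) × G //
      (∀ i, (x i).1 = i) ∧ ∀ i, (cayleyCycleGraph A).Adj (x i) (x (i + 1))} ≤
      Fintype.card G * #(zeroSumTuples A) := by
  have hadj : ∀ x : Fin (m + 3) → Fin (m + 3) × G, (∀ i, (x i).1 = i) →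
      (∀ i, (cayleyCycleGraph A).Adj (x i) (x (i + 1))) →
      ∀ i, (x (i + 1)).2 - (x i).2 ∈ A i := by
    intro x h1 h2 i
    rw [← cayleyCycleGraph_adj]
    convert h2 i using 1
    · exact Prod.ext (h1 i).symm rfl
    · exact Prod.ext (h1 (i + 1)).symm rfl
  let f : {x : Fin (m + 3) → Fin (m + 3) × G //
      (∀ i, (x i).1 = i) ∧ ∀ i, (cayleyCycleGraph A).Adj (x i) (x (i + 1))} →
      G × {a // a ∈ zeroSumTuples A} := fun x =>
    ((x.1 0).2, ⟨fun i => (x.1 (i + 1)).2 - (x.1 i).2, by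
      rw [zeroSumTuples, mem_filter, Fintype.mem_piFinset]
      refine ⟨hadj x.1 x.2.1 x.2.2, ?_⟩
      rw [sum_sub_distrib, sub_eq_zero]
      exact Equiv.sum_comp (Equiv.addRight (1 : Fin (m + 3))) fun i => (x.1 i).2⟩)
  have hf : Function.Injective f := by
    rintro ⟨x, hx1, hx2⟩ ⟨y, hy1, hy2⟩ hxy
    simp only [f, Prod.mk.injEq, Subtype.mk.injEq] at hxy
    obtain ⟨h0, hd⟩ := hxy
    have : ∀ i, (x i).2 = (y i).2 := by
      intro i
      induction i using Fin.induction with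
      | zero => exact h0
      | succ j ih =>
        have := congrFun hd j.castSucc
        rw [Fin.coeSucc_eq_succ, ih] at this
        exact sub_left_injective this
    refine Subtype.ext (funext fun i => Prod.ext ?_ (this i))
    rw [hx1, hy1]
  refine (Nat.card_le_card_of_injective f hf).trans (le_of_eq ?_)
  rw [Nat.card_prod, Nat.card_eq_fintype_card, Nat.card_eq_fintype_card, Fintype.card_coe]

/-- Given a small set `D` of edges meeting all cycles of the Cayley graph, an element `a` of `A i` is
discarded once `D` contains at least a proportion `1 / k` of the `N` edges that it labels. Each
zero-sum tuple gives `N` edge-disjoint cycles, so it cannot survive. -/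
lemma exists_subsets_of_edges {m : ℕ} (A : Fin (m + 3) → Finset G)
    (D : Finset ((Fin (m + 3) × G) × (Fin (m + 3) × G)))
    (hD : ∀ x : Fin (m + 3) → Fin (m + 3) × G, (∀ i, (x i).1 = i) →
      (∀ i, (cayleyCycleGraph A).Adj (x i) (x (i + 1))) → ∃ i, (x i, x (i + 1)) ∈ D) :
    ∃ A' : Fin (m + 3) → Finset G, (∀ i, A' i ⊆ A i) ∧
      (∀ i, Fintype.card G * #(A i \ A' i) ≤ (m + 3) * #D) ∧ zeroSumTuples A' = ∅ := by
  let E : Fin (m + 3) → G → Finset G := fun i a => {x | ((i, x), (i + 1, x + a)) ∈ D}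
  refine ⟨fun i => {a ∈ A i | (m + 3) * #(E i a) < Fintype.card G}, fun i => filter_subset _ _,
    fun i => ?_, ?_⟩
  · have hle : #((A i \ {a ∈ A i | (m + 3) * #(E i a) < Fintype.card G}).sigma (E i)) ≤ #D := by
      refine card_le_card_of_injOn (fun p => ((i, p.2), (i + 1, p.2 + p.1))) ?_ ?_
      · rintro ⟨a, x⟩ hax
        have h := (mem_sigma.1 hax).2
        exact (mem_filter.1 h).2
      · rintro ⟨a, x⟩ _ ⟨a', x'⟩ _ h
        simp only [Prod.mk.injEq, true_and] at h
        obtain ⟨rfl, h⟩ := h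
        obtain rfl := add_left_cancel h
        rfl
    rw [card_sigma] at hle
    refine le_trans ?_ (Nat.mul_le_mul_left _ hle)
    rw [mul_sum, mul_comm, ← smul_eq_mul]
    refine card_nsmul_le_sum _ _ _ fun a ha => ?_
    simp only [Finset.mem_sdiff, mem_filter, not_and, not_lt] at ha
    exact ha.2 ha.1
  · rw [eq_empty_iff_forall_notMem]
    intro a ha
    rw [zeroSumTuples, mem_filter, Fintype.mem_piFinset] at ha
    obtain ⟨haA, hsum⟩ := ha
    obtain ⟨s, hs⟩ := exists_cyclic_antidifference a hsum
    have hcover : (univ : Finset G) ⊆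
        univ.biUnion fun i => (E i (a i)).image fun y => y - s i := by
      intro z _
      obtain ⟨i, hi⟩ := hD (fun i => (i, z + s i)) (fun _ => rfl) (fun i => by
        rw [cayleyCycleGraph_adj, hs i]
        have := (mem_filter.1 (haA i)).1
        convert this using 1
        abel)
      refine mem_biUnion.2 ⟨i, mem_univ _, mem_image.2 ⟨z + s i, ?_, by abel⟩⟩
      refine mem_filter.2 ⟨mem_univ _, ?_⟩
      rw [hs i, ← add_assoc] at hi
      exact hi
    have h1 : Fintype.card G ≤ ∑ i, #(E i (a i)) :=
      (card_le_card hcover).trans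
        (card_biUnion_le.trans (sum_le_sum fun i _ => card_image_le))
    have h2 : ∑ i, (m + 3) * #(E i (a i)) < ∑ _i : Fin (m + 3), Fintype.card G :=
      sum_lt_sum_of_nonempty univ_nonempty fun i _ => (mem_filter.1 (haA i)).2
    rw [← mul_sum, sum_const, card_univ, Fintype.card_fin, smul_eq_mul] at h2
    exact absurd (Nat.mul_le_mul_left (m + 3) h1) (not_le.2 h2)

end Arithmetic

/-! ### The removal lemma in abelian groups -/

universe u

/-- The removal statement for a fixed pair of parameters: if at most `δ N ^ (k - 1)` of the tuples
sum to zero, then removing at most `ε N` elements from each set destroys all of them. -/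
def RemovalHolds (k : ℕ) (δ ε : ℝ) : Prop :=
  ∀ (G : Type u) [AddCommGroup G] [Fintype G] [DecidableEq G] (A : Fin k → Finset G),
    (#(zeroSumTuples A) : ℝ) ≤ δ * (Fintype.card G : ℝ) ^ (k - 1) →
    ∃ A' : Fin k → Finset G, (∀ i, A' i ⊆ A i) ∧
      (∀ i, (#(A i \ A' i) : ℝ) ≤ ε * (Fintype.card G : ℝ)) ∧ zeroSumTuples A' = ∅

lemma RemovalHolds.mono_left {k : ℕ} {δ δ' ε : ℝ} (h : RemovalHolds.{u} k δ ε) (hδ : δ' ≤ δ) :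
    RemovalHolds.{u} k δ' ε := by
  intro G _ _ _ A hA
  exact h G A (hA.trans (by gcongr))

lemma RemovalHolds.mono_right {k : ℕ} {δ ε ε' : ℝ} (h : RemovalHolds.{u} k δ ε) (hε : ε ≤ ε') :
    RemovalHolds.{u} k δ ε' := by
  intro G _ _ _ A hA
  obtain ⟨A', h1, h2, h3⟩ := h G A hA
  exact ⟨A', h1, fun i => (h2 i).trans (by gcongr), h3⟩

lemma removalHolds_one {k : ℕ} (hk : 0 < k) (δ : ℝ) : RemovalHolds.{u} k δ 1 := by
  intro G _ _ _ A _
  refine ⟨fun _ => ∅, fun i => empty_subset _, fun i => ?_, ?_⟩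
  · rw [one_mul]
    exact_mod_cast card_le_univ _
  · rw [zeroSumTuples, filter_eq_empty_iff]
    intro a ha
    exact absurd (Fintype.mem_piFinset.1 ha ⟨0, hk⟩) (notMem_empty _)

lemma exists_removalHolds (m : ℕ) {ε : ℝ} (hε : 0 < ε) :
    ∃ δ : ℝ, 0 < δ ∧ RemovalHolds.{u} (m + 3) δ ε := by
  have hm : (0 : ℝ) < (m + 3 : ℕ) := by positivity
  obtain ⟨δ, hδ, h⟩ := coloured_cycle_removal.{u} m
    (show 0 < ε / ((m + 3 : ℕ) : ℝ) ^ 3 by positivity)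
  refine ⟨δ, hδ, fun G _ _ _ A hA => ?_⟩
  have hN : (0 : ℝ) < Fintype.card G := by exact_mod_cast Fintype.card_pos
  have hcard : (Fintype.card (Fin (m + 3) × G) : ℝ) = (m + 3 : ℕ) * Fintype.card G := by
    rw [Fintype.card_prod, Fintype.card_fin, Nat.cast_mul]
  have hm1 : (1 : ℝ) ≤ (m + 3 : ℕ) := by exact_mod_cast (by omega : 1 ≤ m + 3)
  obtain ⟨D, hD1, hD2⟩ := h (Fin (m + 3) × G) (cayleyCycleGraph A) Prod.fst (by
    calc _ ≤ ((Fintype.card G * #(zeroSumTuples A) : ℕ) : ℝ) := by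
          exact_mod_cast card_cayleyCycles_le A
      _ ≤ Fintype.card G * (δ * (Fintype.card G : ℝ) ^ (m + 2)) := by
          push_cast
          gcongr
          exact hA
      _ = δ * (1 * (Fintype.card G : ℝ)) ^ (m + 3) := by ring
      _ ≤ _ := by
          rw [hcard]
          gcongr)
  obtain ⟨A', h1, h2, h3⟩ := exists_subsets_of_edges A D hD2
  refine ⟨A', h1, fun i => ?_, h3⟩
  have h4 : (Fintype.card G : ℝ) * #(A i \ A' i) ≤ (m + 3 : ℕ) * #D := by exact_mod_cast h2 i
  rw [hcard] at hD1
  have h5 : (Fintype.card G : ℝ) * #(A i \ A' i) ≤ Fintype.card G * (ε * Fintype.card G) := by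
    refine h4.trans ((mul_le_mul_of_nonneg_left hD1 hm.le).trans (le_of_eq ?_))
    field_simp
  exact le_of_mul_le_mul_left h5 hN

theorem theorem1p5 (k : ℕ) (hk : 3 ≤ k) :
    ∃ δ' : ℝ → ℝ, Tendsto δ' (𝓝[>] 0) (𝓝 0) ∧
      ∀ δ : ℝ, 0 < δ →
      ∀ (G : Type*) [AddCommGroup G] [Fintype G] [DecidableEq G] (A : Fin k → Finset G),
        ((zeroSumTuples A).card : ℝ) ≤ δ * (Fintype.card G : ℝ) ^ (k - 1) →
        ∃ A' : Fin k → Finset G,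
          (∀ i, A' i ⊆ A i) ∧
          (∀ i, ((A i \ A' i).card : ℝ) ≤ δ' δ * (Fintype.card G : ℝ)) ∧
          zeroSumTuples A' = ∅ := by
  obtain ⟨m, rfl⟩ := Nat.exists_eq_add_of_le' hk
  let S : ℝ → Set ℝ := fun δ => {ε | 0 ≤ ε ∧ RemovalHolds (m + 3) δ ε}
  have hne : ∀ δ, (S δ).Nonempty := fun δ => ⟨1, zero_le_one, removalHolds_one (by omega) δ⟩
  have hbdd : ∀ δ, BddBelow (S δ) := fun δ => ⟨0, fun ε hε => hε.1⟩
  -- Adding `δ` makes the value exceed the infimum, which need not be attained.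
  refine ⟨fun δ => sInf (S δ) + δ, ?_, fun δ hδ => ?_⟩
  · rw [Metric.tendsto_nhdsWithin_nhds]
    intro ε hε
    obtain ⟨δ₀, hδ₀, h⟩ := exists_removalHolds m (half_pos hε)
    refine ⟨min δ₀ (ε / 2), by positivity, fun δ hδ hdist => ?_⟩
    have hδ' : 0 < δ := hδ
    rw [Real.dist_eq, sub_zero, abs_of_pos hδ', lt_min_iff] at hdist
    have h1 : sInf (S δ) ≤ ε / 2 :=
      csInf_le (hbdd δ) ⟨by positivity, h.mono_left hdist.1.le⟩
    have h2 : 0 ≤ sInf (S δ) := le_csInf (hne δ) fun ε hε => hε.1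
    rw [Real.dist_eq, sub_zero, abs_of_nonneg (by positivity)]
    linarith
  · obtain ⟨ε, hε, hlt⟩ := exists_lt_of_csInf_lt (hne δ) (lt_add_of_pos_right (sInf (S δ)) hδ)
    exact hε.2.mono_right hlt.le
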